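/- Let $A\in\mathbb{R}^{n\times d_1}$ have rank $r\ge 1$, and let $U=[\mathbf u_1,\dots,\mathbf u_r]\in\mathbb{R}^{n\times r}$ and $V=[\mathbf v_1,\dots,\mathbf v_r]\in\mathbb{R}^{d_1\times r}$ have as columns (corresponding) top-$r$ left and right singular vectors of $A$. Writing $K_{(i)}$ for the $i$-th row of a matrix $K$, define the incoherence $$\mu(r)=\max\Big(\max_{1\le i\le n}\tfrac{n}{r}\|U_{(i)}\|_2^2,\ \max_{1\le j\le d_1}\tfrac{d_1}{r}\|V_{(j)}\|_2^2\Big).$$ Let $M\in\mathbb{R}^{b\times d_1}$ be a fixed matrix with rows $\mathbf m_1^\top,\dots,\mathbf m_b^\top$, all lying in the row space of $A$, and let $\delta>0$. For each $i\in\{1,\dots,b\}$ let $\Omega_i$ be a random subset of $\{1,\dots,d_1\}$ of $s_i$ column indices, drawn uniformly at random without replacement (that is, $\Omega_i$ is uniformly distributed over all subsets of size $s_i$; the joint distribution of $\Omega_1,\dots,\Omega_b$ is arbitrary), and let $\mathbf m_{i,\Omega_i}$ and $V_{\Omega_i}$ consist of the entries of $\mathbf m_i$ and the rows of $V$ indexed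 by $\Omega_i$. If $$s_i\ \ge\ 7\,\mu(r)\,r\,\ln(rb/\delta)\qquad\text{for every } i,$$ then with probability at least $1-\delta$ all the matrices $V_{\Omega_i}^\top V_{\Omega_i}$ are invertible and the completion procedure which from the observed entries outputs the rows $V(V_{\Omega_i}^\top V_{\Omega_i})^{-1}V_{\Omega_i}^\top\mathbf m_{i,\Omega_i}$ recovers $M$ exactly, i.e. $$V(V_{\Omega_i}^\top V_{\Omega_i})^{-1}V_{\Omega_i}^\top\,\mathbf m_{i,\Omega_i}=\mathbf m_i\qquad\text{for all } i=1,\dots,b \text{ simultaneously.}$$ -/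

import Mathlib

open Matrix MeasureTheory ProbabilityTheory

/-- `U` and `V` hold, as columns, the top-`r` left and right singular vectors of `A`:
two orthonormal families with `A vₖ = σₖ uₖ` and `Aᵀ uₖ = σₖ vₖ`, where `σ₀ ≥ σ₁ ≥ …` are
the singular values of `A`, counted with multiplicity. -/
structure IsTopSingularVectors {n d r : ℕ} (A : Matrix (Fin n) (Fin d) ℝ)
    (U : Matrix (Fin n) (Fin r) ℝ) (V : Matrix (Fin d) (Fin r) ℝ) : Prop where
  left_orthonormal : Uᵀ * U = 1
  right_orthonormal : Vᵀ * V = 1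
  mul_right : A * V = U * diagonal (fun k : Fin r => (toEuclideanLin A).singularValues k)
  mul_left : Aᵀ * U = V * diagonal (fun k : Fin r => (toEuclideanLin A).singularValues k)

/-- The incoherence
`μ(r) = max (maxᵢ (n / r) ‖U₍ᵢ₎‖₂²) (maxᵢ (d / r) ‖V₍ᵢ₎‖₂²)`, where `K₍ᵢ₎` is the `i`-th row
of `K`. -/
noncomputable def incoherence {n d r : ℕ} (U : Matrix (Fin n) (Fin r) ℝ)
    (V : Matrix (Fin d) (Fin r) ℝ) : ℝ :=
  max (⨆ i, (n / r : ℝ) * ∑ k, U i k ^ 2) (⨆ j, (d / r : ℝ) * ∑ k, V j k ^ 2)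

/-- `V_Ω`: the rows of `V` indexed by `Ω`. -/
def rowsOn {d r : ℕ} (V : Matrix (Fin d) (Fin r) ℝ) (Ω : Finset (Fin d)) :
    Matrix Ω (Fin r) ℝ :=
  V.submatrix Subtype.val id

/-- `x_Ω`: the entries of `x` indexed by `Ω`. -/
def entriesOn {d : ℕ} (x : Fin d → ℝ) (Ω : Finset (Fin d)) : Ω → ℝ :=
  fun j => x j

/-- The row `V (V_Ωᵀ V_Ω)⁻¹ V_Ωᵀ y` that the algorithm computes from `V` and from the observed
entries `y` at the positions `Ω`. -/
noncomputable def completeRow {d r : ℕ} (V : Matrix (Fin d) (Fin r) ℝ) (Ω : Finset (Fin d))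
    (y : Ω → ℝ) : Fin d → ℝ :=
  V *ᵥ (((rowsOn V Ω)ᵀ * rowsOn V Ω)⁻¹ *ᵥ ((rowsOn V Ω)ᵀ *ᵥ y))

/-- The output of the algorithm: row `i` is computed from the observed entries `y i` at the
positions `Ω i`. -/
noncomputable def completeMatrix {b d r : ℕ} (V : Matrix (Fin d) (Fin r) ℝ)
    (Ω : Fin b → Finset (Fin d)) (y : (i : Fin b) → Ω i → ℝ) : Matrix (Fin b) (Fin d) ℝ :=
  Matrix.of fun i => completeRow V (Ω i) (y i)

/-- With the positions `Ω i` observed in row `i`, the algorithm is well defined (all the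
matrices that it inverts are invertible) and outputs `M`. -/
def RecoversExactly {b d r : ℕ} (V : Matrix (Fin d) (Fin r) ℝ) (M : Matrix (Fin b) (Fin d) ℝ)
    (Ω : Fin b → Finset (Fin d)) : Prop :=
  (∀ i, IsUnit ((rowsOn V (Ω i))ᵀ * rowsOn V (Ω i))) ∧
    completeMatrix V Ω (fun i => entriesOn (M i) (Ω i)) = M

/-! Row `i` is recovered once the rows of `V` indexed by `Ω i` span ℝ^r: their Gram matrix is then
invertible, and `M i` lies in the column space of `V`. The rows of `V` form a Parseval frame with
squared norms at most c = μr/d. For a subspace W, the trace of the projection onto Wᗮ gives codim W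
≤ c · #{j | v j ∉ W} (`finrank_sub_le_mul_card_notMem`). Hence a random new row multiplies the
codimension of the span, on average, by at most 1 - 1/(cd) = 1 - 1/(μr), and after s draws its mean
is at most r · exp(-s/(μr)) (`sum_powersetCard_spanDefect_le`). The codimension is an integer, so
Markov's inequality bounds the failure probability by this mean; a union bound over the rows of `M`
concludes. The constant 7 is not sharp: 1 suffices. -/

open Finset Module in
/-- Double counting of the pairs `T ⊂ insert j T`. -/
theorem succ_mul_sum_powersetCard_succ {ι : Type*} [Fintype ι] [DecidableEq ι]
    (f : Finset ι → ℝ) (s : ℕ) :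
    ((s : ℝ) + 1) * ∑ T ∈ powersetCard (s + 1) univ, f T =
      ∑ T ∈ powersetCard s univ, ∑ j ∈ Tᶜ, f (insert j T) := by
  have h : ((s : ℝ) + 1) * ∑ T ∈ powersetCard (s + 1) (univ : Finset ι), f T =
      ∑ T ∈ powersetCard (s + 1) (univ : Finset ι), ∑ _j ∈ T, f T := by
    rw [mul_sum]
    refine sum_congr rfl fun T hT => ?_
    rw [sum_const, (mem_powersetCard.1 hT).2, nsmul_eq_mul]
    push_cast
    rfl
  rw [h, sum_sigma', sum_sigma']
  refine sum_bij' (fun x _ => ⟨x.1.erase x.2, x.2⟩) (fun x _ => ⟨insert x.2 x.1, x.2⟩)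
    ?_ ?_ ?_ ?_ ?_
  · rintro ⟨T, j⟩ hx
    simp only [mem_sigma, mem_powersetCard, subset_univ, true_and, mem_compl] at hx ⊢
    exact ⟨by rw [card_erase_of_mem hx.2]; omega, notMem_erase _ _⟩
  · rintro ⟨T, j⟩ hx
    simp only [mem_sigma, mem_powersetCard, subset_univ, true_and, mem_compl] at hx ⊢
    exact ⟨by rw [card_insert_of_notMem hx.2]; omega, mem_insert_self _ _⟩
  · rintro ⟨T, j⟩ hx
    simp only [mem_sigma] at hx
    simp [insert_erase hx.2]
  · rintro ⟨T, j⟩ hx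
    simp only [mem_sigma, mem_compl] at hx
    simp [erase_insert hx.2]
  · rintro ⟨T, j⟩ hx
    simp only [mem_sigma] at hx
    simp [insert_erase hx.2]

/-! ### Random subsets of a Parseval frame -/

section Frame

variable {E ι : Type*} [NormedAddCommGroup E] [InnerProductSpace ℝ E] [FiniteDimensional ℝ E]
  [Fintype ι] [DecidableEq ι]

open Finset Module

omit [DecidableEq ι] in
open scoped Classical in
/-- A Parseval frame with short vectors has many vectors outside any proper subspace. -/
theorem finrank_sub_le_mul_card_notMem (v : ι → E) (hv : ∀ x, ∑ j, inner ℝ (v j) x ^ 2 = ‖x‖ ^ 2)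
    {c : ℝ} (hc : ∀ j, ‖v j‖ ^ 2 ≤ c) (W : Submodule ℝ E) :
    (finrank ℝ E : ℝ) - finrank ℝ W ≤ c * #{j | v j ∉ W} := by
  -- Expand each ‖e l‖² = 1 in the frame and swap the sums: index `j` contributes 0 if `v j ∈ W`,
  -- and at most ‖v j‖² by Bessel otherwise.
  let e := stdOrthonormalBasis ℝ Wᗮ
  have he : Orthonormal ℝ (fun l => (e l : E)) := e.orthonormal.comp_linearIsometry Wᗮ.subtypeₗᵢ
  have h1 : (finrank ℝ E : ℝ) - finrank ℝ W = ∑ l, ∑ j, inner ℝ (v j) (e l : E) ^ 2 := by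
    have h := W.finrank_add_finrank_orthogonal
    simp only [hv, he.1]
    simp [← h]
  rw [h1, sum_comm, mul_comm, ← nsmul_eq_mul, ← sum_const, sum_filter]
  refine sum_le_sum fun j _ => ?_
  by_cases hj : v j ∈ W
  · rw [if_neg (not_not.2 hj)]
    refine (sum_eq_zero fun l _ => ?_).le
    rw [Submodule.inner_right_of_mem_orthogonal hj (e l).2]
    simp
  · rw [if_pos hj]
    refine le_trans ?_ (hc j)
    have := he.sum_inner_products_le (x := v j) (s := univ)
    simpa [real_inner_comm] using this

/-- The codimension of the span of the vectors indexed by `T`. -/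
noncomputable def spanDefect (v : ι → E) (T : Finset ι) : ℝ :=
  finrank ℝ E - finrank ℝ (Submodule.span ℝ (v '' T))

omit [Fintype ι] [DecidableEq ι] in
theorem spanDefect_nonneg (v : ι → E) (T : Finset ι) : 0 ≤ spanDefect v T :=
  sub_nonneg.2 (by exact_mod_cast Submodule.finrank_le _)

omit [Fintype ι] [DecidableEq ι] in
theorem one_le_spanDefect (v : ι → E) {T : Finset ι} (h : Submodule.span ℝ (v '' T) ≠ ⊤) :
    1 ≤ spanDefect v T := by
  have := Submodule.finrank_lt h
  rw [spanDefect, le_sub_iff_add_le']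
  exact_mod_cast this

omit [Fintype ι] in
open scoped Classical in
theorem spanDefect_insert_le (v : ι → E) (T : Finset ι) (j : ι) :
    spanDefect v (insert j T) ≤
      spanDefect v T - if v j ∉ Submodule.span ℝ (v '' T) then 1 else 0 := by
  have hle : Submodule.span ℝ (v '' T) ≤ Submodule.span ℝ (v '' (insert j T : Finset ι)) :=
    Submodule.span_mono (Set.image_mono (by simp))
  unfold spanDefect
  by_cases hj : v j ∉ Submodule.span ℝ (v '' T)
  · rw [if_pos hj]
    have hlt : Submodule.span ℝ (v '' T) < Submodule.span ℝ (v '' (insert j T : Finset ι)) := by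
      refine lt_of_le_of_ne hle fun h => hj ?_
      rw [h]
      exact Submodule.subset_span ⟨j, by simp, rfl⟩
    have h : ((finrank ℝ (Submodule.span ℝ (v '' T)) + 1 : ℕ) : ℝ) ≤
        finrank ℝ (Submodule.span ℝ (v '' (insert j T : Finset ι))) :=
      Nat.cast_le.2 (Submodule.finrank_lt_finrank_of_lt hlt)
    push_cast at h ⊢
    linarith
  · rw [if_neg hj]
    have h : ((finrank ℝ (Submodule.span ℝ (v '' T)) : ℕ) : ℝ) ≤
        finrank ℝ (Submodule.span ℝ (v '' (insert j T : Finset ι))) :=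
      Nat.cast_le.2 (Submodule.finrank_mono hle)
    linarith

/-- Adding a uniformly random new vector shrinks the defect by a constant factor on average. -/
theorem sum_compl_spanDefect_insert_le (v : ι → E)
    (hv : ∀ x, ∑ j, inner ℝ (v j) x ^ 2 = ‖x‖ ^ 2)
    {c : ℝ} (hc0 : 0 < c) (hc : ∀ j, ‖v j‖ ^ 2 ≤ c) (T : Finset ι) :
    ∑ j ∈ Tᶜ, spanDefect v (insert j T) ≤
      #Tᶜ * (Real.exp (-(1 / (c * Fintype.card ι))) * spanDefect v T) := by
  classical
  have hD := spanDefect_nonneg v T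
  rcases Nat.eq_zero_or_pos (Fintype.card ι) with h0 | hN
  · have : IsEmpty ι := Fintype.card_eq_zero_iff.1 h0
    rw [Subsingleton.elim Tᶜ ∅]
    simp
  have hN' : (0 : ℝ) < Fintype.card ι := by exact_mod_cast hN
  -- Every vector outside the span has its index outside `T`, so it is still available to be drawn.
  have hout : #({j | v j ∉ Submodule.span ℝ (v '' T)} : Finset ι) =
      ∑ j ∈ Tᶜ, if v j ∉ Submodule.span ℝ (v '' T) then 1 else 0 := by
    rw [sum_boole, Nat.cast_id]
    congr 1
    ext j
    simp only [mem_filter, mem_univ, true_and, mem_compl, iff_and_self]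
    exact fun hj hjT => hj (Submodule.subset_span ⟨j, by simpa using hjT, rfl⟩)
  have hcard := finrank_sub_le_mul_card_notMem v hv hc (Submodule.span ℝ (v '' T))
  rw [hout] at hcard
  change spanDefect v T ≤ _ at hcard
  -- Drawing without replacement only helps: the new vectors lie among #Tᶜ ≤ N candidates.
  have hle : (#Tᶜ : ℝ) ≤ Fintype.card ι := by exact_mod_cast card_le_univ _
  have hexp := Real.add_one_le_exp (-(1 / (c * Fintype.card ι)))
  have hkey : (#Tᶜ : ℝ) * (1 / (c * Fintype.card ι) * spanDefect v T) ≤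
      ∑ j ∈ Tᶜ, if v j ∉ Submodule.span ℝ (v '' T) then (1 : ℝ) else 0 := by
    push_cast at hcard
    calc (#Tᶜ : ℝ) * (1 / (c * Fintype.card ι) * spanDefect v T)
        ≤ Fintype.card ι * (1 / (c * Fintype.card ι) * spanDefect v T) := by gcongr
      _ = spanDefect v T / c := by field_simp
      _ ≤ _ := by rw [div_le_iff₀' hc0]; exact hcard
  calc ∑ j ∈ Tᶜ, spanDefect v (insert j T)
      ≤ ∑ j ∈ Tᶜ, (spanDefect v T - if v j ∉ Submodule.span ℝ (v '' T) then 1 else 0) :=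
        sum_le_sum fun j _ => spanDefect_insert_le v T j
    _ ≤ #Tᶜ * ((-(1 / (c * Fintype.card ι)) + 1) * spanDefect v T) := by
        rw [sum_sub_distrib, sum_const, nsmul_eq_mul]
        linarith
    _ ≤ _ := by gcongr

/-- Induction on `s`: a uniform (s+1)-set is a uniform s-set plus a uniform new element, by the
double count, and each addition costs one factor exp(-1/(cN)). -/
theorem sum_powersetCard_spanDefect_le (v : ι → E)
    (hv : ∀ x, ∑ j, inner ℝ (v j) x ^ 2 = ‖x‖ ^ 2)
    {c : ℝ} (hc0 : 0 < c) (hc : ∀ j, ‖v j‖ ^ 2 ≤ c) (s : ℕ) :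
    ∑ T ∈ powersetCard s univ, spanDefect v T ≤
      (Fintype.card ι).choose s * (finrank ℝ E * Real.exp (-(s / (c * Fintype.card ι)))) := by
  induction s with
  | zero => simp [spanDefect]
  | succ s ih =>
    rcases lt_or_ge (Fintype.card ι) s with hs | hs
    · rw [powersetCard_eq_empty.2 (by rw [card_univ]; omega), sum_empty]
      positivity
    set N := Fintype.card ι
    set q := Real.exp (-(1 / (c * N))) with hq
    have hcompl : ∀ T ∈ powersetCard s (univ : Finset ι), (#Tᶜ : ℝ) = N - s := fun T hT => by
      rw [card_compl, (mem_powersetCard.1 hT).2, Nat.cast_sub hs]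
    have hs' : (0 : ℝ) ≤ N - s := sub_nonneg.2 (by exact_mod_cast hs)
    have hch : ((N.choose (s + 1) : ℕ) : ℝ) * (s + 1) = N.choose s * (N - s) := by
      have := Nat.choose_succ_right_eq N s
      rw [← Nat.cast_sub hs]
      exact_mod_cast this
    have hexp : Real.exp (-((s + 1 : ℕ) / (c * N))) = q * Real.exp (-(s / (c * N))) := by
      rw [hq, ← Real.exp_add]
      congr 1
      push_cast
      ring
    have hpos : (0 : ℝ) < s + 1 := by positivity
    refine le_of_mul_le_mul_left ?_ hpos
    calc ((s : ℝ) + 1) * ∑ T ∈ powersetCard (s + 1) univ, spanDefect v T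
        = ∑ T ∈ powersetCard s univ, ∑ j ∈ Tᶜ, spanDefect v (insert j T) :=
          succ_mul_sum_powersetCard_succ _ s
      _ ≤ ∑ T ∈ powersetCard s univ, (N - s) * (q * spanDefect v T) := by
          refine sum_le_sum fun T hT => ?_
          rw [← hcompl T hT]
          exact sum_compl_spanDefect_insert_le v hv hc0 hc T
      _ = (N - s) * (q * ∑ T ∈ powersetCard s univ, spanDefect v T) := by
          rw [mul_sum, mul_sum]
      _ ≤ (N - s) * (q * (N.choose s * (finrank ℝ E * Real.exp (-(s / (c * N)))))) := by
          gcongr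
      _ = N.choose s * (N - s) * (finrank ℝ E * (q * Real.exp (-(s / (c * N))))) := by ring
      _ = _ := by rw [← hch, hexp]; ring

open scoped Classical in
/-- A uniformly random set of `s` vectors of a Parseval frame fails to span with exponentially
small probability. -/
theorem card_span_ne_top_le (v : ι → E)
    (hv : ∀ x, ∑ j, inner ℝ (v j) x ^ 2 = ‖x‖ ^ 2)
    {c : ℝ} (hc0 : 0 < c) (hc : ∀ j, ‖v j‖ ^ 2 ≤ c) (s : ℕ) :
    (#((powersetCard s univ).filter fun T : Finset ι => Submodule.span ℝ (v '' T) ≠ ⊤) : ℝ) ≤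
      (finrank ℝ E * Real.exp (-(s / (c * Fintype.card ι)))) *
        #(powersetCard s (univ : Finset ι)) := by
  rw [card_powersetCard, card_univ, mul_comm]
  refine le_trans ?_ (sum_powersetCard_spanDefect_le v hv hc0 hc s)
  rw [card_eq_sum_ones, Nat.cast_sum, sum_filter]
  -- Markov's inequality, termwise: a nonzero defect is at least 1.
  refine sum_le_sum fun T _ => ?_
  split_ifs with h
  · simpa using one_le_spanDefect v h
  · exact spanDefect_nonneg v T

end Frame

/-! ### Singular vectors, incoherence and recovery -/

/-- The rows of `V`, as vectors of a Euclidean space. -/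
noncomputable def euclideanRow {d r : ℕ} (V : Matrix (Fin d) (Fin r) ℝ) (j : Fin d) :
    EuclideanSpace ℝ (Fin r) :=
  WithLp.toLp 2 (V j)

theorem inner_euclideanRow {d r : ℕ} (V : Matrix (Fin d) (Fin r) ℝ) (j : Fin d)
    (x : EuclideanSpace ℝ (Fin r)) : inner ℝ (euclideanRow V j) x = (V *ᵥ x.ofLp) j := by
  simp [euclideanRow, PiLp.inner_apply, mulVec, dotProduct, mul_comm]

theorem norm_sq_euclideanRow {d r : ℕ} (V : Matrix (Fin d) (Fin r) ℝ) (j : Fin d) :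
    ‖euclideanRow V j‖ ^ 2 = ∑ k, V j k ^ 2 := by
  simp [euclideanRow, EuclideanSpace.norm_sq_eq]

theorem sum_inner_euclideanRow_sq {d r : ℕ} {V : Matrix (Fin d) (Fin r) ℝ} (hV : Vᵀ * V = 1)
    (x : EuclideanSpace ℝ (Fin r)) : ∑ j, inner ℝ (euclideanRow V j) x ^ 2 = ‖x‖ ^ 2 := by
  have h : (V *ᵥ x.ofLp) ⬝ᵥ (V *ᵥ x.ofLp) = x.ofLp ⬝ᵥ x.ofLp := by
    rw [dotProduct_mulVec, vecMul_mulVec, hV, vecMul_one]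
  simp only [inner_euclideanRow, EuclideanSpace.norm_sq_eq, Real.norm_eq_abs, sq_abs]
  simpa [dotProduct, pow_two] using h

/-- A kernel vector of the Gram matrix is orthogonal to every row in `Ω`, hence to the whole space.
-/
theorem isUnit_gram_of_span_eq_top {d r : ℕ} (V : Matrix (Fin d) (Fin r) ℝ) (Ω : Finset (Fin d))
    (h : Submodule.span ℝ (euclideanRow V '' Ω) = ⊤) :
    IsUnit ((rowsOn V Ω)ᵀ * rowsOn V Ω) := by
  rw [← mulVec_injective_iff_isUnit]
  refine (injective_iff_map_eq_zero (mulVecLin ((rowsOn V Ω)ᵀ * rowsOn V Ω))).2 ?_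
  intro x hx
  have h0 : rowsOn V Ω *ᵥ x = 0 := by
    rw [← dotProduct_self_eq_zero, dotProduct_mulVec, ← mulVec_transpose, mulVec_mulVec]
    rw [mulVecLin_apply] at hx
    rw [hx, zero_dotProduct]
  have hmem : WithLp.toLp 2 x ∈ (Submodule.span ℝ (euclideanRow V '' Ω))ᗮ := by
    rw [Submodule.mem_orthogonal]
    intro u hu
    induction hu using Submodule.span_induction with
    | mem u hu =>
      obtain ⟨j, hj, rfl⟩ := hu
      rw [inner_euclideanRow]
      exact congrFun h0 ⟨j, hj⟩
    | zero => simp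
    | add a b _ _ ha hb => rw [inner_add_left, ha, hb, add_zero]
    | smul c a _ ha => rw [inner_smul_left, ha, mul_zero]
  rw [h, Submodule.top_orthogonal_eq_bot, Submodule.mem_bot] at hmem
  exact congrArg WithLp.ofLp hmem

/-- The row space of `A` is the column space of `V`. -/
theorem IsTopSingularVectors.span_rows {n d r : ℕ} {A : Matrix (Fin n) (Fin d) ℝ}
    {U : Matrix (Fin n) (Fin r) ℝ} {V : Matrix (Fin d) (Fin r) ℝ}
    (h : IsTopSingularVectors A U V) (hA : A.rank = r) :
    Submodule.span ℝ (Set.range A) = LinearMap.range V.mulVecLin := by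
  have hspan : Submodule.span ℝ (Set.range A) = LinearMap.range Aᵀ.mulVecLin := by
    rw [range_mulVecLin]
    rfl
  have hrank : Module.finrank ℝ (LinearMap.range (toEuclideanLin A)) = r := by
    rw [← hA, toEuclideanLin, toLpLin_eq_toLin, ← rank_eq_finrank_range_toLin]
  have hσ : ∀ k : Fin r, (toEuclideanLin A).singularValues k ≠ 0 := fun k => by
    refine ne_of_gt ((toEuclideanLin A).singularValues_pos_iff_lt_finrank_range.2 ?_)
    rw [hrank]
    exact k.2
  rw [hspan]
  symm
  apply Submodule.eq_of_le_of_finrank_eq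
  · rintro _ ⟨x, rfl⟩
    -- With Σ the invertible diagonal of singular values, Aᵀ U Σ⁻¹ x = V x.
    refine ⟨U *ᵥ (diagonal (fun k : Fin r => ((toEuclideanLin A).singularValues k)⁻¹) *ᵥ x), ?_⟩
    rw [mulVecLin_apply, mulVecLin_apply, mulVec_mulVec, mulVec_mulVec, h.mul_left, Matrix.mul_assoc,
      diagonal_mul_diagonal]
    simp [hσ]
  · change V.rank = Aᵀ.rank
    rw [rank_transpose, hA, ← rank_transpose_mul_self, h.right_orthonormal, rank_one,
      Fintype.card_fin]

theorem recoversExactly_of_isUnit {b d r : ℕ} (V : Matrix (Fin d) (Fin r) ℝ)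
    (M : Matrix (Fin b) (Fin d) ℝ) (hM : ∀ i, M i ∈ LinearMap.range V.mulVecLin)
    (Ω : Fin b → Finset (Fin d)) (h : ∀ i, IsUnit ((rowsOn V (Ω i))ᵀ * rowsOn V (Ω i))) :
    RecoversExactly V M Ω := by
  refine ⟨h, funext fun i => ?_⟩
  obtain ⟨x, hx⟩ := hM i
  rw [mulVecLin_apply] at hx
  have he : entriesOn (M i) (Ω i) = rowsOn V (Ω i) *ᵥ x := by
    rw [← hx]
    rfl
  change completeRow V (Ω i) (entriesOn (M i) (Ω i)) = M i
  rw [he, completeRow, mulVec_mulVec x, mulVec_mulVec x,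
    nonsing_inv_mul _ ((isUnit_iff_isUnit_det _).1 (h i)), one_mulVec, hx]

theorem row_sq_sum_le_incoherence {n d r : ℕ} (hr : 1 ≤ r) (U : Matrix (Fin n) (Fin r) ℝ)
    (V : Matrix (Fin d) (Fin r) ℝ) (j : Fin d) :
    ∑ k, V j k ^ 2 ≤ incoherence U V * r / d := by
  have hd : (0 : ℝ) < d := by exact_mod_cast j.pos
  have hr' : (0 : ℝ) < r := by exact_mod_cast hr
  have h : (d / r : ℝ) * ∑ k, V j k ^ 2 ≤ incoherence U V :=
    (le_ciSup (f := fun j => (d / r : ℝ) * ∑ k, V j k ^ 2) (Set.finite_range _).bddAbove j).trans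
      (le_max_right _ _)
  rw [le_div_iff₀ hd]
  calc (∑ k, V j k ^ 2) * d = (d / r : ℝ) * (∑ k, V j k ^ 2) * r := by field_simp
    _ ≤ _ := by gcongr

/-- The squared row norms of `V` sum to r, so the largest is at least the average r/d. -/
theorem one_le_incoherence {n d r : ℕ} (hr : 1 ≤ r) (U : Matrix (Fin n) (Fin r) ℝ)
    {V : Matrix (Fin d) (Fin r) ℝ} (hV : Vᵀ * V = 1) : 0 < d ∧ 1 ≤ incoherence U V := by
  have hr' : (0 : ℝ) < r := by exact_mod_cast hr
  have hsum : ∑ j, ∑ k, V j k ^ 2 = (r : ℝ) := by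
    have h : (Vᵀ * V).trace = r := by rw [hV, trace_one, Fintype.card_fin]
    rw [← h, Finset.sum_comm]
    simp [trace, mul_apply, pow_two]
  have hd : 0 < d := by
    rcases Nat.eq_zero_or_pos d with rfl | hd
    · rw [Finset.univ_eq_empty, Finset.sum_empty] at hsum
      exact absurd hsum hr'.ne
    · exact hd
  have hd' : (0 : ℝ) < d := by exact_mod_cast hd
  refine ⟨hd, ?_⟩
  have h := Finset.sum_le_sum fun j (_ : j ∈ Finset.univ) => row_sq_sum_le_incoherence hr U V j
  rw [hsum, Finset.sum_const, Finset.card_univ, Fintype.card_fin, nsmul_eq_mul,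
    mul_div_cancel₀ _ hd'.ne'] at h
  exact le_of_mul_le_mul_right (by linarith) hr'

/-! ### Probability bounds -/

theorem uniformOn_span_ne_top_le {n d r : ℕ} (hr : 1 ≤ r) (U : Matrix (Fin n) (Fin r) ℝ)
    {V : Matrix (Fin d) (Fin r) ℝ} (hV : Vᵀ * V = 1) (s : ℕ) :
    (uniformOn {T : Finset (Fin d) | T.card = s}).real
        {T | Submodule.span ℝ (euclideanRow V '' T) ≠ ⊤} ≤
      r * Real.exp (-(s / (incoherence U V * r))) := by
  classical
  obtain ⟨hd, hμ⟩ := one_le_incoherence hr U hV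
  have hd' : (0 : ℝ) < d := by exact_mod_cast hd
  have hr' : (0 : ℝ) < r := by exact_mod_cast hr
  have h := card_span_ne_top_le (euclideanRow V) (sum_inner_euclideanRow_sq hV)
    (c := incoherence U V * r / d) (by positivity)
    (fun j => (norm_sq_euclideanRow V j).trans_le (row_sq_sum_le_incoherence hr U V j)) s
  rw [finrank_euclideanSpace, Fintype.card_fin, Fintype.card_fin,
    div_mul_cancel₀ _ hd'.ne'] at h
  have hs : {T : Finset (Fin d) | T.card = s} =
      (Finset.powersetCard s (Finset.univ : Finset (Fin d)) : Set (Finset (Fin d))) := by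
    ext
    simp
  have ht : {T : Finset (Fin d) | Submodule.span ℝ (euclideanRow V '' T) ≠ ⊤} =
      (Finset.univ.filter fun T : Finset (Fin d) =>
        Submodule.span ℝ (euclideanRow V '' T) ≠ ⊤ : Set (Finset (Fin d))) := by
    ext
    simp
  rw [Measure.real, hs, ht, uniformOn_apply_finset, ENNReal.toReal_div, ENNReal.toReal_natCast,
    ENNReal.toReal_natCast, ← Finset.filter_mem_eq_inter]
  -- The denominator is 0 when s > d, and the quotient is then 0.
  refine div_le_of_le_mul₀ (by positivity) (by positivity) (le_trans ?_ h)
  rw [Nat.cast_le]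
  refine Finset.card_le_card fun T => ?_
  simp

theorem mul_exp_neg_div_le {r b s : ℕ} (hr : 1 ≤ r) (hb : 1 ≤ b) {μ δ : ℝ} (hμ : 1 ≤ μ)
    (hδ : 0 < δ) (hδ' : δ ≤ 1) (hs : 7 * μ * r * Real.log (r * b / δ) ≤ s) :
    r * Real.exp (-(s / (μ * r))) ≤ δ / b := by
  have hr' : (1 : ℝ) ≤ r := by exact_mod_cast hr
  have hb' : (1 : ℝ) ≤ b := by exact_mod_cast hb
  -- The sign of the logarithm, which needs δ ≤ rb, allows the factor 7 to be dropped.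
  have hL : 0 ≤ Real.log (r * b / δ) :=
    Real.log_nonneg ((one_le_div hδ).2 (hδ'.trans (one_le_mul_of_one_le_of_one_le hr' hb')))
  have hle : Real.log (r * b / δ) ≤ s / (μ * r) := by
    rw [le_div_iff₀ (by positivity)]
    have : 0 ≤ μ * r * Real.log (r * b / δ) := by positivity
    linarith
  calc r * Real.exp (-(s / (μ * r))) ≤ r * Real.exp (-Real.log (r * b / δ)) := by gcongr
    _ = δ / b := by
      rw [Real.exp_neg, Real.exp_log (by positivity)]
      field_simp

theorem theorem1 {n d b r : ℕ} (hr : 1 ≤ r)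
    (A : Matrix (Fin n) (Fin d) ℝ) (hA : A.rank = r)
    (U : Matrix (Fin n) (Fin r) ℝ) (V : Matrix (Fin d) (Fin r) ℝ)
    (hUV : IsTopSingularVectors A U V)
    (M : Matrix (Fin b) (Fin d) ℝ)
    (hM : ∀ i, M i ∈ Submodule.span ℝ (Set.range A))
    (s : Fin b → ℕ) (δ : ℝ) (hδ : 0 < δ)
    (hs : ∀ i, 7 * incoherence U V * r * Real.log (r * b / δ) ≤ s i)
    {S : Type*} [MeasurableSpace S] (P : Measure S) [IsProbabilityMeasure P]
    (Ω : Fin b → S → Finset (Fin d))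
    (hΩ : ∀ i, HasLaw (Ω i) (uniformOn {T : Finset (Fin d) | T.card = s i}) P) :
    1 - δ ≤ P.real {ω | RecoversExactly V M (fun i => Ω i ω)} := by
  rcases lt_or_ge 1 δ with hδ1 | hδ1
  · linarith [measureReal_nonneg (μ := P) (s := {ω | RecoversExactly V M (fun i => Ω i ω)})]
  rw [hUV.span_rows hA] at hM
  have hV := hUV.right_orthonormal
  let B : Set (Finset (Fin d)) := {T | Submodule.span ℝ (euclideanRow V '' T) ≠ ⊤}
  have hbad : ∀ i, P.real (Ω i ⁻¹' B) ≤ δ / b := fun i => by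
    have hb : 1 ≤ b := i.pos
    have hmap : IsProbabilityMeasure (P.map (Ω i)) :=
      Measure.isProbabilityMeasure_map (hΩ i).aemeasurable
    calc P.real (Ω i ⁻¹' B) ≤ (P.map (Ω i)).real B :=
          ENNReal.toReal_mono (measure_ne_top _ _) (Measure.le_map_apply (hΩ i).aemeasurable B)
      _ ≤ r * Real.exp (-(s i / (incoherence U V * r))) := by
          rw [(hΩ i).map_eq]
          exact uniformOn_span_ne_top_le hr U hV (s i)
      _ ≤ δ / b := mul_exp_neg_div_le hr hb (one_le_incoherence hr U hV).2 hδ hδ1 (hs i)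
  have hunion : P.real (⋃ i, Ω i ⁻¹' B) ≤ δ := by
    refine (measureReal_iUnion_fintype_le _).trans
      ((Finset.sum_le_sum fun i _ => hbad i).trans ?_)
    rw [Finset.sum_const, Finset.card_univ, Fintype.card_fin, nsmul_eq_mul]
    rcases Nat.eq_zero_or_pos b with rfl | hb
    · simpa using hδ.le
    · rw [mul_div_cancel₀ _ (by positivity)]
  -- Subadditivity of this cover bounds the recovery event from below without its measurability.
  have hcover : (Set.univ : Set S) ⊆
      {ω | RecoversExactly V M (fun i => Ω i ω)} ∪ ⋃ i, Ω i ⁻¹' B := by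
    intro ω _
    by_cases h : ω ∈ ⋃ i, Ω i ⁻¹' B
    · exact Or.inr h
    · refine Or.inl (recoversExactly_of_isUnit V M hM _ fun i =>
        isUnit_gram_of_span_eq_top V _ ?_)
      by_contra hi
      exact h (Set.mem_iUnion.2 ⟨i, hi⟩)
  have h1 : 1 ≤ P.real {ω | RecoversExactly V M (fun i => Ω i ω)} + P.real (⋃ i, Ω i ⁻¹' B) := by
    rw [← probReal_univ (μ := P)]
    exact (measureReal_mono hcover).trans (measureReal_union_le _ _)
  linarith
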